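/- Let $R$ be a finite Frobenius ring (not necessarily commutative, with identity), i.e. a finite ring with a character $\chi\colon(R,+)\to\mathbb{C}^\times$ whose kernel contains no nonzero left ideal. Let $$\mathrm{w}_{\mathrm{hom}}(x)=1-\frac{1}{|R^\times|}\sum_{u\in R^\times}\chi(ux)\qquad(x\in R)$$ be the normalized homogeneous weight on $R$, and put $\mathrm{w}_{\mathrm{hom}}(\mathbf{c})=\sum_{j=1}^n \mathrm{w}_{\mathrm{hom}}(c_j)$ for $\mathbf{c}\in R^n$. Let $C\le {}_RR^n$ be a left linear code without all-zero coordinate. Suppose that $C$ is modular: $C=\{\mathbf{x}G : \mathbf{x}\in R^k\}$ for some matrix $G\in R^{k\times n}$ with columns $\mathbf{g}_1,\dots,\mathbf{g}_n$ for which there is $r\in\mathbb{Q}$ such that for every nonzero $\mathbf{g}\in R^k$ the number $|\{j : \mathbf{g}_jR=\mathbf{g}R\}|$ is either $0$ or $r\,|\mathbf{g}R^\times|$. Suppose also that $C$ is a two-weight code: the words of $C$ have exactly two nonzero homogeneous weights $w_1<w_2$. Let $C_0=\{\mathbf{c}\in C : \mathrm{w}_{\mathrm{hom}}(\mathbf{c})=0\}$,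 which is a subgroup of $(C,+)$, and $C_1=\{\mathbf{c}\in C : \mathrm{w}_{\mathrm{hom}}(\mathbf{c})=w_1\}$. Let $\Gamma(C)$ be the Cayley graph of the group $C/C_0$ with respect to $C_1/C_0=\{\mathbf{c}+C_0 : \mathbf{c}\in C_1\}$, i.e. the graph with vertex set $C/C_0$ and edges $\{x,x+d\}$ for $x\in C/C_0$, $d\in C_1/C_0$. Then $\Gamma(C)$ is strongly regular with parameters $(N,K,\lambda,\mu)$ (that is, it has $N$ vertices, is regular of degree $K$, and any two adjacent, respectively distinct nonadjacent, vertices have exactly $\lambda$, respectively $\mu$, common neighbours), where $$N=\frac{|C|}{|C_0|},\qquad K=\frac{(w_2-n)N-w_2}{w_2-w_1},$$ $$\lambda=\frac{K\left(\frac{w_1^2}{n}-2w_1\right)+w_2(K-1)}{w_2-w_1},\qquad \mu=\frac{K\left(\frac{w_1w_2}{n}-w_1-w_2\right)+w_2K}{w_2-w_1}.$$ Moreover, $\Gamma(C)$ is trivial, i.e. $\Gamma(C)$ or its complement is a disjoint union of cliques of the same size, if and only if $w_1=n$. -/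

import Mathlib

noncomputable section

namespace FrobeniusCode

/-- A character of the additive group of `R` whose kernel contains no nonzero left ideal
(`Ideal R` is the type of left ideals of `R`). A finite ring is a Frobenius ring if and only if
it has such a character. -/
def IsGenerating {R : Type*} [Ring R] (χ : AddChar R ℂ) : Prop :=
  ∀ I : Ideal R, (∀ x ∈ I, χ x = 1) → I = ⊥

/-- The normalized homogeneous weight `1 - |Rˣ|⁻¹ ∑ χ (u x)`, the sum running over the units `u`,
on a finite Frobenius ring with generating character `χ`. -/
def homWeight {R : Type*} [Ring R] [Fintype R] [DecidableEq R] (χ : AddChar R ℂ) (x : R) : ℂ :=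
  1 - (1 / (Fintype.card Rˣ : ℂ)) * ∑ u : Rˣ, χ ((u : R) * x)

/-- The homogeneous weight of a word: the sum of the weights of its coordinates. -/
def wordWeight {R : Type*} [Ring R] [Fintype R] [DecidableEq R] (χ : AddChar R ℂ) {n : ℕ}
    (c : Fin n → R) : ℂ :=
  ∑ j, homWeight χ (c j)

/-- The columns of the matrix `G` as elements of the right module `R^k`. For a vector `g`, this is
the number of columns `g_j` with `g_j R = g R`. -/
def pointMultiplicity {R : Type*} [Ring R] {k n : ℕ} (G : Matrix (Fin k) (Fin n) R)
    (g : Fin k → R) : ℕ :=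
  {j : Fin n | Submodule.span Rᵐᵒᵖ {fun i => G i j} = Submodule.span Rᵐᵒᵖ {g}}.ncard

/-- The orbit `g Rˣ`. -/
def unitOrbit {R : Type*} [Ring R] {k : ℕ} (g : Fin k → R) : Set (Fin k → R) :=
  Set.range fun u : Rˣ => fun i => g i * (u : R)

/-- A left linear code without all-zero coordinate is modular (of index `r`) if it is the left row
space of a matrix `G` such that each point `g R` of the projective geometry on the right module
`R^k` has multiplicity `0` or `r |g Rˣ|` among the points spanned by the columns of `G`. -/
def IsModular {R : Type*} [Ring R] {n : ℕ} (C : Submodule R (Fin n → R)) : Prop :=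
  (∀ j, ∃ c ∈ C, c j ≠ 0) ∧
  ∃ (k : ℕ) (G : Matrix (Fin k) (Fin n) R) (r : ℚ),
    (C : Set (Fin n → R)) = Set.range (fun x : Fin k → R => Matrix.vecMul x G) ∧
    ∀ g : Fin k → R, g ≠ 0 →
      pointMultiplicity G g = 0 ∨ (pointMultiplicity G g : ℚ) = r * ((unitOrbit g).ncard : ℚ)

/-- The code `C` has exactly two nonzero homogeneous weights `w₁ < w₂`. -/
def IsTwoWeight {R : Type*} [Ring R] [Fintype R] [DecidableEq R] (χ : AddChar R ℂ) {n : ℕ}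
    (C : Submodule R (Fin n → R)) (w₁ w₂ : ℝ) : Prop :=
  w₁ < w₂ ∧ {z : ℂ | z ≠ 0 ∧ ∃ c ∈ C, wordWeight χ c = z} = {(w₁ : ℂ), (w₂ : ℂ)}

section Helpers

variable {R : Type*} [Ring R] [Fintype R] [DecidableEq R] (χ : AddChar R ℂ)

lemma homWeight_re (x : R) : (homWeight χ x).re =
    (1 / (Fintype.card Rˣ : ℝ)) * ∑ u : Rˣ, (1 - (χ ((u : R) * x)).re) := by
  have h0 : (Fintype.card Rˣ : ℝ) ≠ 0 := by exact_mod_cast Fintype.card_ne_zero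
  have e : (1 / (Fintype.card Rˣ : ℂ)) = ((1 / (Fintype.card Rˣ : ℝ) : ℝ) : ℂ) := by push_cast; rfl
  rw [homWeight, e, Complex.sub_re, Complex.re_ofReal_mul, Complex.re_sum, Finset.sum_sub_distrib]
  simp only [Complex.one_re, Finset.sum_const, Finset.card_univ, nsmul_eq_mul]
  field_simp

lemma re_le_one (x : R) : (χ x).re ≤ 1 :=
  (Complex.re_le_norm _).trans (AddChar.norm_apply χ x).le

lemma homWeight_re_nonneg (x : R) : 0 ≤ (homWeight χ x).re := by
  rw [homWeight_re]
  exact mul_nonneg (by positivity)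
    (Finset.sum_nonneg fun u _ => sub_nonneg.2 (re_le_one χ _))

lemma apply_eq_one_of_homWeight_re {x : R} (h : (homWeight χ x).re = 0) (u : Rˣ) :
    χ ((u : R) * x) = 1 := by
  have h0 : (Fintype.card Rˣ : ℝ) ≠ 0 := by exact_mod_cast Fintype.card_ne_zero
  rw [homWeight_re] at h
  have h1 := (mul_eq_zero.1 h).resolve_left (by simpa using h0)
  rw [Finset.sum_eq_zero_iff_of_nonneg (fun u _ => sub_nonneg.2 (re_le_one χ _))] at h1
  have h2 : (χ ((u : R) * x)).re = 1 := by linarith [h1 u (Finset.mem_univ u)]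
  have h3 : ‖χ ((u : R) * x)‖ = 1 := AddChar.norm_apply χ _
  have h4 : Complex.normSq (χ ((u : R) * x)) = 1 := by rw [Complex.normSq_eq_norm_sq, h3]; norm_num
  rw [Complex.normSq_apply, h2] at h4
  exact Complex.ext h2 (by simpa using h4)

lemma homWeight_eq_zero_iff (x : R) :
    homWeight χ x = 0 ↔ ∀ u : Rˣ, χ ((u : R) * x) = 1 := by
  refine ⟨fun h => apply_eq_one_of_homWeight_re χ (by rw [h]; rfl), fun h => ?_⟩
  have h0 : (Fintype.card Rˣ : ℂ) ≠ 0 := by exact_mod_cast Fintype.card_ne_zero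
  simp [homWeight, h]

lemma wordWeight_eq_zero_iff {n : ℕ} (c : Fin n → R) :
    wordWeight χ c = 0 ↔ ∀ j, ∀ u : Rˣ, χ ((u : R) * c j) = 1 := by
  refine ⟨fun h j => apply_eq_one_of_homWeight_re χ ?_, fun h => ?_⟩
  · have h1 : ∑ j, (homWeight χ (c j)).re = 0 := by
      rw [← Complex.re_sum]; exact congrArg Complex.re h
    exact (Finset.sum_eq_zero_iff_of_nonneg fun j _ => homWeight_re_nonneg χ _).1 h1 j
      (Finset.mem_univ j)
  · exact Finset.sum_eq_zero fun j _ => (homWeight_eq_zero_iff χ _).2 (h j)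

end Helpers

/-- The subgroup `C₀` of all codewords of `C` of homogeneous weight `0`. -/
def zeroWeight {R : Type*} [Ring R] [Fintype R] [DecidableEq R] (χ : AddChar R ℂ) {n : ℕ}
    (C : Submodule R (Fin n → R)) : AddSubgroup C where
  carrier := {c | wordWeight χ (c : Fin n → R) = 0}
  zero_mem' := by simp [wordWeight_eq_zero_iff]
  add_mem' := by
    intro a b ha hb
    simp only [Set.mem_setOf_eq, wordWeight_eq_zero_iff] at ha hb ⊢
    intro j u
    simp [mul_add, AddChar.map_add_eq_mul, ha j u, hb j u]
  neg_mem' := by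
    intro a ha
    simp only [Set.mem_setOf_eq, wordWeight_eq_zero_iff] at ha ⊢
    intro j u
    simp [AddChar.map_neg_eq_inv, ha j u]

/-- The graph `Γ(C)`: the Cayley graph of the group `C / C₀` with respect to `C₁ / C₀`, where `C₁`
is the set of codewords of weight `w₁`. -/
def codeGraph {R : Type*} [Ring R] [Fintype R] [DecidableEq R] (χ : AddChar R ℂ) {n : ℕ}
    (C : Submodule R (Fin n → R)) (w₁ : ℝ) : SimpleGraph (C ⧸ zeroWeight χ C) :=
  SimpleGraph.addCayley
    ((fun c : C => (QuotientAddGroup.mk c : C ⧸ zeroWeight χ C)) ''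
      {c : C | wordWeight χ (c : Fin n → R) = (w₁ : ℂ)})

/-- `Γ` is a disjoint union of cliques of the same size. -/
def IsUnionOfEqualCliques {V : Type*} (Γ : SimpleGraph V) : Prop :=
  ∃ (s : Setoid V) (m : ℕ), (∀ x y, Γ.Adj x y ↔ x ≠ y ∧ s x y) ∧ ∀ x, {y | s x y}.ncard = m

/-- A graph is trivial if it or its complement is a disjoint union of cliques of the same size. -/
def IsTrivialGraph {V : Type*} (Γ : SimpleGraph V) : Prop :=
  IsUnionOfEqualCliques Γ ∨ IsUnionOfEqualCliques Γᶜ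

end FrobeniusCode

end

/-!
Let the modular code be `C = {xG}`, and let `H` be the multiset of all vectors `g_j u`, where `g_j`
is a column of `G` and `u` a unit. A generating character satisfies `χ (u x) = χ (x σ(u))` for a
permutation `σ` of the units (the Nakayama automorphism), so `∑ χ (u x) = ∑ χ (x u)` over the units
(`sum_units_apply_mul_comm`), and the weight of `xG` is `n - |Rˣ|⁻¹ ∑_{h ∈ H} χ (x ⬝ h)`
(`wordWeight_vecMul`).

Over a finite ring, vectors generating the same cyclic submodule of the right module `R^k` differ by
a right unit factor (`exists_unit_smul_of_span_eq`). This is a form of stable range one, proved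
modulo the Jacobson radical, where kernel and cokernel of an endomorphism of a semisimple module
receive equally many homomorphisms. Hence the modularity condition says that every vector occurring
in `H` occurs there `r |Rˣ|` times (`card_column_mul_unit_eq`). By orthogonality of characters the
function `n - w(xG)` is then, up to a constant, idempotent under convolution
(`sum_charSum_mul_charSum`), and its sum over `R^k` is zero because no column vanishes. Averages
over `R^k` are averages over `C / C₀`, so on `C / C₀` the weight `W` satisfies
`∑ W = n N` and `∑_c W(c) W(d - c) = N (n² + r (n - W(d)))`.

These two identities determine the graph. As `W` takes only the values `0`, `w₁`, `w₂`, and `0` only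
at `0`, the indicator function of weight `w₁` is a linear combination of `1`, of `W` and of the
indicator function of `0`. So the first identity gives the degree, the second one the number of
representations of `d` as a sum of two elements of weight `w₁`, in terms of `W(d)` only, and its case
`d = 0` eliminates `r` (`isSRGWith_of_weight`).

The formula for the degree `K > 0` forces `n < w₂`, whence `μ > 0`. Then the graph is trivial exactly
when `μ = K` (`isTrivialGraph_iff_of_isSRGWith`), which amounts to `w₁ = n`.
-/

namespace FrobeniusCode

/-! ### Finite rings have stable range one -/

/-- Stable range one for a finite semisimple ring, by induction on the kernel `K` of right
multiplication by `a`. If `K ≠ 0`, there is a nonzero map from `K` to a complement of `S a` inside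
`S c`; extended to `S`, it is right multiplication by some `y c`, and adding `y c` to `a` shrinks
the kernel. -/
lemma exists_unit_add_mul_of_isSemisimpleRing {S : Type*} [Ring S] [Finite S] [IsSemisimpleRing S]
    (a c : S) (h : Ideal.span {a} ⊔ Ideal.span {c} = ⊤) : ∃ y, IsUnit (a + y * c) := by
  let f (a : S) : S →ₗ[S] S := LinearMap.toSpanSingleton S S a
  have hf (a x : S) : f a x = x * a := rfl
  induction hN : Nat.card (LinearMap.ker (f a)) using Nat.strong_induction_on generalizing a with
  | _ N ih =>
  by_cases hK : LinearMap.ker (f a) = ⊥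
  · have hinj : Function.Injective (f a) := LinearMap.ker_eq_bot.1 hK
    obtain ⟨b, hb⟩ := Finite.surjective_of_injective hinj 1
    exact ⟨0, by simpa using IsUnit.of_mul_eq_one_right b hb⟩
  set K := LinearMap.ker (f a) with hKdef
  have hrange : LinearMap.range (f a) = Ideal.span {a} := LinearMap.range_toSpanSingleton a
  obtain ⟨K', hK'⟩ := exists_isCompl K
  -- a complement `D` of `S a` that lies in `S c`
  obtain ⟨D, hDc, hdisj, hsup⟩ : ∃ D ≤ Ideal.span {c}, Disjoint (LinearMap.range (f a)) D ∧
      LinearMap.range (f a) ⊔ D = ⊤ := by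
    obtain ⟨E, hE⟩ := exists_isCompl (Ideal.span {a} ⊓ Ideal.span {c})
    refine ⟨E ⊓ Ideal.span {c}, inf_le_right, ?_, ?_⟩
    · rw [hrange, disjoint_iff, ← hE.inf_eq_bot]; ac_rfl
    · rw [hrange, eq_top_iff, ← h]
      refine sup_le le_sup_left ?_
      calc Ideal.span {c} = (Ideal.span {a} ⊓ Ideal.span {c} ⊔ E) ⊓ Ideal.span {c} := by
            rw [hE.sup_eq_top, top_inf_eq]
        _ = Ideal.span {a} ⊓ Ideal.span {c} ⊔ E ⊓ Ideal.span {c} :=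
            (sup_inf_assoc_of_le E inf_le_right).symm ▸ rfl
        _ ≤ _ := sup_le_sup_right inf_le_left _
  have hfin (A B : Submodule S S) : Finite (A →ₗ[S] B) := DFunLike.finite _
  -- `S` is both `K × S a` and `S a × D`, so `K` has as many maps to `D` as to itself
  have e1 : (K × LinearMap.range (f a)) ≃ₗ[S] (LinearMap.range (f a) × D) :=
    ((LinearEquiv.refl S K).prodCongr ((f a).quotKerEquivRange.symm.trans
      (Submodule.quotientEquivOfIsCompl _ _ hK'))).trans
      ((Submodule.prodEquivOfIsCompl _ _ hK').trans
        (Submodule.prodEquivOfIsCompl _ _ ⟨hdisj, codisjoint_iff.2 hsup⟩).symm)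
  have hcard : Nat.card (K →ₗ[S] K) = Nat.card (K →ₗ[S] D) := by
    have e2 : (K →ₗ[S] K) × (K →ₗ[S] LinearMap.range (f a)) ≃
        (K →ₗ[S] LinearMap.range (f a)) × (K →ₗ[S] D) :=
      (LinearMap.prodEquiv ℕ).toEquiv.trans
        ((Equiv.mk (fun g => e1.toLinearMap ∘ₗ g) (fun g => e1.symm.toLinearMap ∘ₗ g)
          (fun g => by ext1 x; simp) (fun g => by ext1 x; simp)).trans
            (LinearMap.prodEquiv ℕ).symm.toEquiv)
    have := Nat.card_congr e2
    rw [Nat.card_prod, Nat.card_prod, mul_comm] at this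
    exact Nat.eq_of_mul_eq_mul_left Nat.card_pos this
  obtain ⟨φ, hφ⟩ : ∃ φ : K →ₗ[S] D, φ ≠ 0 := by
    by_contra! hall
    have : Subsingleton (K →ₗ[S] D) := ⟨fun x y => (hall x).trans (hall y).symm⟩
    have h1 := (Finite.card_le_one_iff_subsingleton (α := K →ₗ[S] D)).2 this
    have h2 := (Finite.card_le_one_iff_subsingleton (α := K →ₗ[S] K)).1 (hcard ▸ h1)
    apply hK
    rw [Submodule.eq_bot_iff]
    intro x hx
    have := LinearMap.congr_fun (Subsingleton.elim (LinearMap.id : K →ₗ[S] K) 0) ⟨x, hx⟩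
    exact congrArg Subtype.val this
  let p : S →ₗ[S] K := K.projectionOnto K' hK'
  set d : S := (φ (p 1) : S) with hd
  have hmul (x : S) : x * d = (φ (p x) : S) := by
    have : p x = x • p 1 := by rw [← map_smul, smul_eq_mul, mul_one]
    rw [this, map_smul]; rfl
  obtain ⟨y, hy⟩ := Ideal.mem_span_singleton'.1 (hDc (φ (p 1)).2)
  have hker (x : S) (hx : x * (a + y * c) = 0) : x * a = 0 ∧ x * d = 0 := by
    rw [hy, mul_add, ← hd] at hx
    have h1 : x * d ∈ D := hmul x ▸ (φ (p x)).2
    have h2 : x * d ∈ LinearMap.range (f a) := ⟨-x, by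
      rw [hf, neg_mul, eq_comm]; exact eq_neg_of_add_eq_zero_right hx⟩
    have h3 : x * d = 0 := by
      simpa using (Submodule.disjoint_def.1 hdisj) _ h2 h1
    exact ⟨by simpa [h3] using hx, h3⟩
  have hlt : LinearMap.ker (f (a + y * c)) < K := by
    refine lt_of_le_of_ne (fun x hx => (hker x hx).1) fun heq => hφ ?_
    ext1 k
    have h1 : (k : S) ∈ LinearMap.ker (f (a + y * c)) := by rw [heq]; exact k.2
    have h2 := (hker _ h1).2
    rw [hmul] at h2
    have h3 : p k = k := Submodule.projectionOnto_apply_left hK' k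
    refine Subtype.ext (Eq.trans ?_ h2)
    change (φ k : S) = φ (p k)
    rw [h3]
  have hspan : Ideal.span {a + y * c} ⊔ Ideal.span {c} = ⊤ := by
    rw [eq_top_iff, ← h]
    refine sup_le ?_ le_sup_right
    rw [Ideal.span_singleton_le_iff_mem]
    have key : a + y * c - y * c ∈ Ideal.span {a + y * c} ⊔ Ideal.span {c} :=
      sub_mem (Ideal.mem_sup_left (Ideal.mem_span_singleton_self _))
        (Ideal.mem_sup_right (Ideal.mul_mem_left _ _ (Ideal.mem_span_singleton_self _)))
    rwa [add_sub_cancel_right] at key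
  obtain ⟨z, hz⟩ := ih _ (hN ▸ Set.Finite.card_lt_card (Set.toFinite _) hlt) _ hspan rfl
  exact ⟨y + z, by rwa [add_mul, ← add_assoc]⟩

/-- Stable range one for a finite ring: modulo the Jacobson radical the ring is semisimple, and an
element that is a unit modulo the radical is a unit. -/
lemma exists_unit_add_mul_of_finite {R : Type*} [Ring R] [Finite R] {a b c : R}
    (h : b * a + c = 1) : ∃ y, IsUnit (a + y * c) := by
  let π := Ideal.Quotient.mk (Ring.jacobson R)
  have hspan : Ideal.span {π a} ⊔ Ideal.span {π c} = ⊤ := by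
    rw [Ideal.eq_top_iff_one, ← map_one π, ← h, map_add, map_mul]
    exact add_mem (Ideal.mem_sup_left (Ideal.mul_mem_left _ _ (Ideal.mem_span_singleton_self _)))
      (Ideal.mem_sup_right (Ideal.mem_span_singleton_self _))
  have : Finite (R ⧸ Ring.jacobson R) := Finite.of_surjective π Ideal.Quotient.mk_surjective
  obtain ⟨y, hy⟩ := exists_unit_add_mul_of_isSemisimpleRing (π a) (π c) hspan
  obtain ⟨y, rfl⟩ := Ideal.Quotient.mk_surjective y
  refine ⟨y, ?_⟩
  obtain ⟨z, hz⟩ := hy.exists_left_inv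
  obtain ⟨z, rfl⟩ := Ideal.Quotient.mk_surjective z
  have hz' : 1 - z * (a + y * c) ∈ Ring.jacobson R := by
    rw [← Ideal.Quotient.mk_eq_mk_iff_sub_mem, map_one, map_mul, map_add, map_mul]
    exact hz.symm
  have htop : Ideal.span {a + y * c} = ⊤ := by
    by_contra hne
    obtain ⟨m, hm, hle⟩ := Ideal.exists_le_maximal _ hne
    apply hm.ne_top
    rw [Ideal.eq_top_iff_one, ← sub_add_cancel 1 (z * (a + y * c))]
    exact add_mem (Ring.jacobson_le_of_isMaximal m hz')
      (m.mul_mem_left _ (hle (Ideal.mem_span_singleton_self _)))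
  obtain ⟨t, ht⟩ := Ideal.mem_span_singleton'.1 ((Ideal.eq_top_iff_one _).1 htop)
  exact IsUnit.of_mul_eq_one_right t ht

/-- Vectors spanning the same cyclic submodule of the right module `R^k` over a finite ring are
right unit multiples of each other. -/
lemma exists_unit_smul_of_span_eq {R : Type*} [Ring R] [Finite R] {k : ℕ} {g h : Fin k → R}
    (hgh : Submodule.span Rᵐᵒᵖ {g} = Submodule.span Rᵐᵒᵖ {h}) :
    ∃ u : Rˣ, h = fun i => g i * (u : R) := by
  obtain ⟨a, ha⟩ := Submodule.mem_span_singleton.1 (hgh ▸ Submodule.mem_span_singleton_self h)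
  obtain ⟨b, hb⟩ := Submodule.mem_span_singleton.1
    (hgh.symm ▸ Submodule.mem_span_singleton_self g : g ∈ Submodule.span Rᵐᵒᵖ {h})
  have : Finite Rᵐᵒᵖ := Finite.of_equiv R MulOpposite.opEquiv
  -- `1 - b * a` annihilates `g`, so `a` may be changed by a left multiple of it
  obtain ⟨y, u, hu⟩ := exists_unit_add_mul_of_finite (a := a) (b := b) (c := 1 - b * a)
    (by abel)
  have hu' : (u : Rᵐᵒᵖ) • g = h := by
    rw [hu, add_smul, mul_smul, sub_smul, mul_smul, ha, hb, one_smul, sub_self, smul_zero, add_zero]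
  refine ⟨Units.opEquiv u |>.unop, ?_⟩
  rw [← hu']
  rfl

/-! ### Generating characters -/

section Characters

variable {R : Type*} [Ring R] [Fintype R] {χ : AddChar R ℂ}

lemma exists_apply_mul_ne_one (hχ : IsGenerating χ) {b : R} (hb : b ≠ 0) :
    ∃ x, χ (x * b) ≠ 1 := by
  by_contra! h
  refine hb (Ideal.span_singleton_eq_bot.1 (hχ (Ideal.span {b}) fun x hx => ?_))
  obtain ⟨a, rfl⟩ := Ideal.mem_span_singleton'.1 hx
  exact h a

/-- Every character of `(R, +)` has the form `x ↦ χ (x b)`: distinct `b` give distinct characters,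
and there are only `|R|` characters. -/
lemma exists_eq_apply_mul (hχ : IsGenerating χ) (ψ : AddChar R ℂ) : ∃ b, ∀ x, ψ x = χ (x * b) := by
  let F (b : R) : AddChar R ℂ := χ.compAddMonoidHom (AddMonoidHom.mulRight b)
  have hF (b x : R) : F b x = χ (x * b) := rfl
  have hinj : Function.Injective F := by
    intro b c hbc
    by_contra hne
    obtain ⟨x, hx⟩ := exists_apply_mul_ne_one hχ (sub_ne_zero.2 hne)
    apply hx
    rw [mul_sub, AddChar.map_sub_eq_div, ← hF, ← hF, hbc, div_self]
    exact fun h0 => by simpa [h0] using AddChar.norm_apply (F c) x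
  have hbij := (Fintype.bijective_iff_injective_and_card F).2 ⟨hinj, AddChar.card_eq.symm⟩
  obtain ⟨b, rfl⟩ := hbij.2 ψ
  exact ⟨b, hF b⟩

/-- The Nakayama automorphism `σ`, restricted to the units: `χ (u x) = χ (x σ(u))`. -/
lemma exists_units_hom_apply_mul_comm (hχ : IsGenerating χ) :
    ∃ σ : Rˣ →* Rˣ, Function.Injective σ ∧ ∀ (u : Rˣ) (x : R), χ (u * x) = χ (x * σ u) := by
  have hex (a : R) : ∃ b, ∀ x, χ (a * x) = χ (x * b) :=
    exists_eq_apply_mul hχ (χ.compAddMonoidHom (AddMonoidHom.mulLeft a))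
  choose τ hτ using hex
  have huniq {b c : R} (h : ∀ x, χ (x * b) = χ (x * c)) : b = c := by
    by_contra hne
    obtain ⟨x, hx⟩ := exists_apply_mul_ne_one hχ (sub_ne_zero.2 hne)
    apply hx
    rw [mul_sub, AddChar.map_sub_eq_div, h, div_self]
    exact fun h0 => by simpa [h0] using AddChar.norm_apply χ (x * c)
  let σ : R →* R :=
    { toFun := τ
      map_one' := huniq fun x => by rw [← hτ, one_mul, mul_one]
      map_mul' := fun a b => huniq fun x => by
        rw [← hτ, mul_assoc, hτ, mul_assoc, hτ, mul_assoc] }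
  have hσ : Function.Injective σ := by
    intro a b hab
    -- every character takes the same value at `a` and `b`
    refine AddChar.doubleDualEmb_injective (DFunLike.ext _ _ fun ψ => ?_)
    obtain ⟨c, hc⟩ := exists_eq_apply_mul hχ ψ
    simp only [AddChar.doubleDualEmb_apply]
    rw [hc, hc, hτ a, hτ b, show τ a = τ b from hab]
  exact ⟨Units.map σ, Units.map_injective hσ, fun u x => hτ u x⟩

lemma sum_units_apply_mul_comm [DecidableEq R] (hχ : IsGenerating χ) (x : R) :
    ∑ u : Rˣ, χ (u * x) = ∑ u : Rˣ, χ (x * u) := by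
  obtain ⟨σ, hσ, h⟩ := exists_units_hom_apply_mul_comm hχ
  simp_rw [h]
  exact Fintype.sum_bijective σ (Finite.injective_iff_bijective.1 hσ) _ _ fun _ => rfl

/-- Orthogonality: `x ↦ χ (x ⬝ v)` is a nontrivial character unless `v = 0`. -/
lemma sum_apply_dotProduct [DecidableEq R] (hχ : IsGenerating χ) {k : ℕ} (v : Fin k → R) :
    ∑ x : Fin k → R, χ (x ⬝ᵥ v) = if v = 0 then (Fintype.card R : ℂ) ^ k else 0 := by
  let ψ : AddChar (Fin k → R) ℂ := χ.compAddMonoidHom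
    { toFun := fun x => x ⬝ᵥ v, map_zero' := zero_dotProduct v, map_add' := fun x y =>
      add_dotProduct x y v }
  have hψ (x : Fin k → R) : ψ x = χ (x ⬝ᵥ v) := rfl
  simp_rw [← hψ]
  split_ifs with hv
  · simp [hψ, hv]
  · rw [AddChar.sum_eq_zero_iff_ne_zero]
    obtain ⟨i, hi⟩ := Function.ne_iff.1 hv
    obtain ⟨x, hx⟩ := exists_apply_mul_ne_one hχ hi
    intro h0
    apply hx
    have := DFunLike.congr_fun h0 (Pi.single i x)
    rwa [hψ, single_dotProduct] at this

end Characters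

/-! ### Weights of the words of a modular code -/

section Modular

variable {R : Type*} [Ring R] [Fintype R] [DecidableEq R] {χ : AddChar R ℂ} {k n : ℕ}

/-- The orbit-stabilizer theorem for the units acting on `R^k` from the right. -/
lemma ncard_unitOrbit_mul_card (g : Fin k → R) :
    (unitOrbit g).ncard * (Finset.univ.filter fun u : Rˣ => (fun i => g i * (u : R)) = g).card =
      Fintype.card Rˣ := by
  classical
  let F (u : Rˣ) : Fin k → R := fun i => g i * (u : R)
  have h1 := Finset.card_eq_sum_card_image F Finset.univ
  have h2 : ∀ b ∈ Finset.univ.image F, (Finset.univ.filter fun u => F u = b).card =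
      (Finset.univ.filter fun u => F u = g).card := by
    intro b hb
    obtain ⟨v, -, rfl⟩ := Finset.mem_image.1 hb
    refine Finset.card_bij (fun u _ => u * v⁻¹) ?_ (by simp) ?_
    · intro u hu
      simp only [Finset.mem_filter_univ] at hu ⊢
      ext i
      have := congrFun hu i
      simp only [F] at this ⊢
      rw [Units.val_mul, ← mul_assoc, this, mul_assoc, Units.mul_inv, mul_one]
    · intro u hu
      simp only [Finset.mem_filter_univ] at hu
      refine ⟨u * v, ?_, by simp⟩
      simp only [Finset.mem_filter_univ]
      ext i
      have := congrFun hu i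
      simp only [F] at this ⊢
      rw [Units.val_mul, ← mul_assoc, this]
  rw [Finset.sum_congr rfl h2, Finset.sum_const, smul_eq_mul, Finset.card_univ] at h1
  rw [h1]
  congr 1
  rw [unitOrbit, ← Set.ncard_coe_finset]
  simp [F]

/-- The number of pairs `(j, u)` with `g_j u = h`: each column spanning the point of `h` contributes
the order of the stabilizer of `h`, so the modularity condition and the orbit-stabilizer theorem
give `r |Rˣ|`. -/
lemma card_column_mul_unit_eq {G : Matrix (Fin k) (Fin n) R} {r : ℚ} {h : Fin k → R}
    (hr : pointMultiplicity G h = 0 ∨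
      (pointMultiplicity G h : ℚ) = r * ((unitOrbit h).ncard : ℚ))
    {j₀ : Fin n} {u₀ : Rˣ} (h₀ : (fun i => G i j₀ * (u₀ : R)) = h) :
    ((∑ j, (Finset.univ.filter fun u : Rˣ => (fun i => G i j * (u : R)) = h).card : ℕ) : ℚ) =
      r * Fintype.card Rˣ := by
  classical
  have hspan (j : Fin n) (u : Rˣ) (hu : (fun i => G i j * (u : R)) = h) :
      Submodule.span Rᵐᵒᵖ {fun i => G i j} = Submodule.span Rᵐᵒᵖ {h} := by
    have : h = (Units.opEquiv.symm (MulOpposite.op u) : Rᵐᵒᵖˣ) • fun i => G i j := by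
      rw [← hu]; rfl
    rw [this, Submodule.span_singleton_group_smul_eq]
  have hterm (j : Fin n) : (Finset.univ.filter fun u : Rˣ => (fun i => G i j * (u : R)) = h).card =
      if Submodule.span Rᵐᵒᵖ {fun i => G i j} = Submodule.span Rᵐᵒᵖ {h} then
        (Finset.univ.filter fun u : Rˣ => (fun i => h i * (u : R)) = h).card else 0 := by
    split_ifs with hj
    · obtain ⟨v, hv⟩ := exists_unit_smul_of_span_eq hj
      refine Finset.card_bij (fun u _ => v⁻¹ * u) ?_ (by simp) ?_
      · intro u hu
        simp only [Finset.mem_filter_univ] at hu ⊢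
        ext i
        refine Eq.trans ?_ (congrFun hu i)
        rw [congrFun hv i, Units.val_mul, mul_assoc, Units.mul_inv_cancel_left]
      · intro u hu
        simp only [Finset.mem_filter_univ] at hu
        refine ⟨v * u, ?_, by simp⟩
        simp only [Finset.mem_filter_univ]
        ext i
        rw [Units.val_mul, ← mul_assoc]
        exact (congrArg (· * (u : R)) (congrFun hv i).symm).trans (congrFun hu i)
    · rw [Finset.card_eq_zero, Finset.filter_eq_empty_iff]
      exact fun u _ hu => hj (hspan j u hu)
  have hmult : pointMultiplicity G h = (Finset.univ.filter fun j =>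
      Submodule.span Rᵐᵒᵖ {fun i => G i j} = Submodule.span Rᵐᵒᵖ {h}).card := by
    rw [pointMultiplicity, ← Set.ncard_coe_finset]
    simp
  have hpos : pointMultiplicity G h ≠ 0 := by
    rw [hmult, Finset.card_ne_zero]
    exact ⟨j₀, by simpa using hspan j₀ u₀ h₀⟩
  rw [Finset.sum_congr rfl fun j _ => hterm j, ← Finset.sum_filter, Finset.sum_const, smul_eq_mul,
    ← hmult, Nat.cast_mul, hr.resolve_left hpos, mul_assoc, ← Nat.cast_mul,
    ncard_unitOrbit_mul_card]

lemma wordWeight_vecMul (hχ : IsGenerating χ) (G : Matrix (Fin k) (Fin n) R) (x : Fin k → R) :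
    wordWeight χ (Matrix.vecMul x G) =
      n - (1 / (Fintype.card Rˣ : ℂ)) *
        ∑ p : Fin n × Rˣ, χ (x ⬝ᵥ fun i => G i p.1 * (p.2 : R)) := by
  simp only [wordWeight, homWeight, Finset.sum_sub_distrib, Finset.sum_const, Finset.card_univ,
    Fintype.card_fin, nsmul_eq_mul, mul_one, ← Finset.mul_sum, Fintype.sum_prod_type]
  congr 2
  refine Finset.sum_congr rfl fun j _ => ?_
  rw [sum_units_apply_mul_comm hχ]
  refine Finset.sum_congr rfl fun u _ => ?_
  congr 1
  simp [Matrix.vecMul, dotProduct, Finset.sum_mul, mul_assoc]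

lemma sum_wordWeight_vecMul (hχ : IsGenerating χ) {G : Matrix (Fin k) (Fin n) R}
    (hG : ∀ j, (fun i => G i j) ≠ 0) :
    ∑ x : Fin k → R, wordWeight χ (Matrix.vecMul x G) = n * (Fintype.card R : ℂ) ^ k := by
  simp only [wordWeight_vecMul hχ, Finset.sum_sub_distrib, ← Finset.mul_sum]
  rw [Finset.sum_comm, Finset.sum_eq_zero (s := Finset.univ (α := Fin n × Rˣ))]
  · simp [mul_comm]
  · intro p _
    rw [sum_apply_dotProduct hχ, if_neg]
    intro h
    apply hG p.1
    ext i
    simpa using congrFun h i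

/-- Up to a constant, `∑ χ (x ⬝ h)` over the unit multiples `h` of the columns of `G` is idempotent
under convolution: by orthogonality only pairs with `h = h'` survive, and modularity says that each
`h` occurs equally often. -/
lemma sum_charSum_mul_charSum (hχ : IsGenerating χ) {G : Matrix (Fin k) (Fin n) R}
    (hG : ∀ j, (fun i => G i j) ≠ 0) {r : ℚ}
    (hr : ∀ g : Fin k → R, g ≠ 0 →
      pointMultiplicity G g = 0 ∨ (pointMultiplicity G g : ℚ) = r * ((unitOrbit g).ncard : ℚ))
    (x : Fin k → R) :
    ∑ y : Fin k → R, (∑ p : Fin n × Rˣ, χ (y ⬝ᵥ fun i => G i p.1 * (p.2 : R))) *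
        (∑ p : Fin n × Rˣ, χ ((x - y) ⬝ᵥ fun i => G i p.1 * (p.2 : R))) =
      (Fintype.card R : ℂ) ^ k * r * Fintype.card Rˣ *
        ∑ p : Fin n × Rˣ, χ (x ⬝ᵥ fun i => G i p.1 * (p.2 : R)) := by
  let h (p : Fin n × Rˣ) : Fin k → R := fun i => G i p.1 * (p.2 : R)
  have hne (p) : h p ≠ 0 := by
    intro h0
    apply hG p.1
    ext i
    simpa [h] using congrFun h0 i
  have hcount (q : Fin n × Rˣ) :
      ((Finset.univ.filter fun p => h p = h q).card : ℂ) = r * Fintype.card Rˣ := by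
    have h1 := card_column_mul_unit_eq (hr (h q) (hne q)) (j₀ := q.1) (u₀ := q.2) rfl
    have h2 : (Finset.univ.filter fun p => h p = h q).card =
        ∑ j, (Finset.univ.filter fun u : Rˣ => (fun i => G i j * (u : R)) = h q).card := by
      simp only [Finset.card_filter, Fintype.sum_prod_type]
      rfl
    rw [h2]
    exact_mod_cast congrArg (fun z : ℚ => (z : ℂ)) h1
  have hterm (q p : Fin n × Rˣ) : ∑ y : Fin k → R, χ (y ⬝ᵥ h p) * χ ((x - y) ⬝ᵥ h q) =
      χ (x ⬝ᵥ h q) * if h p = h q then (Fintype.card R : ℂ) ^ k else 0 := by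
    have : (h p = h q) = (h p - h q = 0) := by rw [sub_eq_zero]
    simp only [this, ← sum_apply_dotProduct hχ, Finset.mul_sum]
    refine Finset.sum_congr rfl fun y _ => ?_
    rw [← AddChar.map_add_eq_mul, ← AddChar.map_add_eq_mul]
    congr 1
    rw [sub_dotProduct, dotProduct_sub]
    abel
  calc ∑ y : Fin k → R, (∑ p, χ (y ⬝ᵥ h p)) * (∑ q, χ ((x - y) ⬝ᵥ h q))
      = ∑ q, ∑ p, ∑ y : Fin k → R, χ (y ⬝ᵥ h p) * χ ((x - y) ⬝ᵥ h q) := by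
        simp only [Finset.sum_mul_sum]
        rw [Finset.sum_comm]
        simp_rw [Finset.sum_comm (s := Finset.univ (α := Fin k → R))]
        rw [Finset.sum_comm]
    _ = ∑ q, χ (x ⬝ᵥ h q) * ((Fintype.card R : ℂ) ^ k * (r * Fintype.card Rˣ)) := by
        refine Finset.sum_congr rfl fun q _ => ?_
        simp only [hterm]
        rw [← Finset.mul_sum, ← Finset.sum_filter, Finset.sum_const, nsmul_eq_mul, hcount]
        ring
    _ = _ := by
        rw [← Finset.sum_mul]
        ring

/-- The convolution of the weight with itself, as a function on `R^k`, is an affine function of the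
weight. -/
lemma sum_wordWeight_mul_wordWeight (hχ : IsGenerating χ) {G : Matrix (Fin k) (Fin n) R}
    (hG : ∀ j, (fun i => G i j) ≠ 0) {r : ℚ}
    (hr : ∀ g : Fin k → R, g ≠ 0 →
      pointMultiplicity G g = 0 ∨ (pointMultiplicity G g : ℚ) = r * ((unitOrbit g).ncard : ℚ))
    (x : Fin k → R) :
    ∑ y : Fin k → R, wordWeight χ (Matrix.vecMul y G) * wordWeight χ (Matrix.vecMul (x - y) G) =
      (Fintype.card R : ℂ) ^ k * (n ^ 2 + r * (n - wordWeight χ (Matrix.vecMul x G))) := by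
  have hU : (Fintype.card Rˣ : ℂ) ≠ 0 := by exact_mod_cast Fintype.card_ne_zero
  have h1 := sum_wordWeight_vecMul hχ hG
  have h2 : ∑ y : Fin k → R, wordWeight χ (Matrix.vecMul (x - y) G) =
      n * (Fintype.card R : ℂ) ^ k := by
    rw [← h1]
    exact Fintype.sum_equiv (Equiv.subLeft x) _ _ fun _ => rfl
  have h3 := sum_charSum_mul_charSum hχ hG hr x
  have hs (y : Fin k → R) : ∑ p : Fin n × Rˣ, χ (y ⬝ᵥ fun i => G i p.1 * (p.2 : R)) =
      Fintype.card Rˣ * (n - wordWeight χ (Matrix.vecMul y G)) := by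
    rw [wordWeight_vecMul hχ]
    field_simp
    ring
  simp only [hs] at h3
  have h4 : ∑ y : Fin k → R, (n - wordWeight χ (Matrix.vecMul y G)) *
      (n - wordWeight χ (Matrix.vecMul (x - y) G)) =
      (Fintype.card R : ℂ) ^ k * r * (n - wordWeight χ (Matrix.vecMul x G)) := by
    apply mul_left_cancel₀ (pow_ne_zero 2 hU)
    rw [Finset.mul_sum]
    calc _ = _ := Finset.sum_congr rfl fun y _ => by ring
      _ = _ := h3
      _ = _ := by ring
  have h5 (y : Fin k → R) : wordWeight χ (Matrix.vecMul y G) *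
      wordWeight χ (Matrix.vecMul (x - y) G) =
      (n - wordWeight χ (Matrix.vecMul y G)) * (n - wordWeight χ (Matrix.vecMul (x - y) G)) +
      n * wordWeight χ (Matrix.vecMul y G) + n * wordWeight χ (Matrix.vecMul (x - y) G) -
      n ^ 2 := by ring
  simp only [h5, Finset.sum_sub_distrib, Finset.sum_add_distrib, ← Finset.mul_sum, h1, h2, h4]
  simp
  ring

end Modular

/-! ### Cayley graphs of two-valued weights -/

section Weight

variable {V : Type*} [AddCommGroup V] [Fintype V] [DecidableEq V] {W : V → ℝ} {w₁ w₂ n ρ : ℝ}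

lemma sum_weight_eq (h0 : ∀ v, W v = 0 ↔ v = 0) (hW : ∀ v, W v = 0 ∨ W v = w₁ ∨ W v = w₂)
    (hw₁ : 0 < w₁) (hw : w₁ < w₂) :
    ∑ v, W v = w₂ * (Fintype.card V - 1) -
      (w₂ - w₁) * (Finset.univ.filter fun v => W v = w₁).card := by
  have h (v : V) : W v = w₂ - w₂ * (if v = 0 then 1 else 0) -
      (w₂ - w₁) * (if W v = w₁ then 1 else 0) := by
    rcases hW v with hv | hv | hv
    · rw [if_pos ((h0 v).1 hv), hv, if_neg hw₁.ne]; ring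
    · rw [if_neg (fun h => hw₁.ne' (hv ▸ (h0 v).2 h)), if_pos hv, hv]; ring
    · rw [if_neg (fun h => (hw₁.trans hw).ne' (hv ▸ (h0 v).2 h)), hv, if_neg hw.ne']; ring
  rw [Finset.sum_congr rfl fun v _ => h v]
  simp only [Finset.sum_sub_distrib, ← Finset.mul_sum]
  simp
  ring

lemma sum_weight_sq_eq (h0 : ∀ v, W v = 0 ↔ v = 0) (hW : ∀ v, W v = 0 ∨ W v = w₁ ∨ W v = w₂) :
    ∑ v, W v ^ 2 = (w₁ + w₂) * ∑ v, W v - w₁ * w₂ * (Fintype.card V - 1) := by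
  have h (v : V) : W v ^ 2 = (w₁ + w₂) * W v - w₁ * w₂ * (1 - if v = 0 then 1 else 0) := by
    by_cases hv0 : v = 0
    · rw [if_pos hv0, (h0 v).2 hv0]; ring
    · rw [if_neg hv0]
      rcases hW v with hv | hv | hv
      · exact absurd ((h0 v).1 hv) hv0
      all_goals rw [hv]; ring
  rw [Finset.sum_congr rfl fun v _ => h v]
  simp only [Finset.sum_sub_distrib, ← Finset.mul_sum]
  simp

/-- The convolution of `W` with itself at `d ≠ 0` in terms of the number of representations of `d` as
a sum of two elements of weight `w₁`: write `w₂ - W` as a combination of the indicator functions of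
`0` and of weight `w₁`, and expand. -/
lemma sum_weight_mul_weight_eq (h0 : ∀ v, W v = 0 ↔ v = 0)
    (hW : ∀ v, W v = 0 ∨ W v = w₁ ∨ W v = w₂) (hw₁ : 0 < w₁) (hw : w₁ < w₂) {d : V} (hd : d ≠ 0) :
    ∑ c, W c * W (d - c) = 2 * w₂ * ∑ v, W v - w₂ ^ 2 * Fintype.card V +
      2 * w₂ * (w₂ - w₁) * (if W d = w₁ then 1 else 0) +
      (w₂ - w₁) ^ 2 * (Finset.univ.filter fun c => W c = w₁ ∧ W (d - c) = w₁).card := by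
  let e (v : V) : ℝ := if W v = w₁ then 1 else 0
  let z (v : V) : ℝ := if v = 0 then 1 else 0
  have h (v : V) : w₂ - W v = w₂ * z v + (w₂ - w₁) * e v := by
    simp only [e, z]
    rcases hW v with hv | hv | hv
    · rw [if_pos ((h0 v).1 hv), hv, if_neg hw₁.ne]; ring
    · rw [if_neg (fun h => hw₁.ne' (hv ▸ (h0 v).2 h)), if_pos hv, hv]; ring
    · rw [if_neg (fun h => (hw₁.trans hw).ne' (hv ▸ (h0 v).2 h)), hv, if_neg hw.ne']; ring
  have hprod (c : V) : W c * W (d - c) = w₂ * W c + w₂ * W (d - c) - w₂ ^ 2 +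
      (w₂ ^ 2 * (z c * z (d - c)) + w₂ * (w₂ - w₁) * (z c * e (d - c)) +
        w₂ * (w₂ - w₁) * (z (d - c) * e c) + (w₂ - w₁) ^ 2 * (e c * e (d - c))) := by
    linear_combination (w₂ - W c) * h (d - c) + (w₂ * z (d - c) + (w₂ - w₁) * e (d - c)) * h c
  have hrefl (F : V → ℝ) : ∑ c, F (d - c) = ∑ c, F c :=
    Fintype.sum_equiv (Equiv.subLeft d) _ _ fun _ => rfl
  have hz (F : V → ℝ) : ∑ c, z c * F c = F 0 := by simp [z]
  have s1 : ∑ c, z c * z (d - c) = 0 := by rw [hz fun c => z (d - c)]; simp [z, hd]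
  have s2 : ∑ c, z c * e (d - c) = e d := by rw [hz fun c => e (d - c)]; simp
  have s3 : ∑ c, z (d - c) * e c = e d := by
    rw [← s2, ← hrefl]; simp
  have s4 : ∑ c, e c * e (d - c) =
      (Finset.univ.filter fun c => W c = w₁ ∧ W (d - c) = w₁).card := by
    rw [Finset.natCast_card_filter]
    refine Finset.sum_congr rfl fun c _ => ?_
    simp only [e]
    split_ifs <;> simp_all
  rw [Finset.sum_congr rfl fun c _ => hprod c]
  simp only [Finset.sum_sub_distrib, Finset.sum_add_distrib, ← Finset.mul_sum, s1, s2, s3, s4,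
    hrefl W]
  simp only [Finset.sum_const, Finset.card_univ, nsmul_eq_mul, e]
  ring

/-- Let `W` be a symmetric weight on a finite abelian group with the two nonzero values `w₁ < w₂`,
average `n`, and such that `W - n` is, up to a constant, idempotent under convolution. Then the
elements of weight `w₁` define a strongly regular Cayley graph. -/
theorem isSRGWith_of_weight {Γ : SimpleGraph V} [DecidableRel Γ.Adj]
    (hΓ : ∀ x y, Γ.Adj x y ↔ W (y - x) = w₁)
    (h0 : ∀ v, W v = 0 ↔ v = 0) (hW : ∀ v, W v = 0 ∨ W v = w₁ ∨ W v = w₂)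
    (hneg : ∀ v, W (-v) = W v) (hw₁ : 0 < w₁) (hw : w₁ < w₂) (hex₁ : ∃ v, W v = w₁)
    (hex₂ : ∃ v, W v = w₂) (hn : 0 < n) (hsum : ∑ v, W v = n * Fintype.card V)
    (hconv : ∀ d, ∑ c, W c * W (d - c) = Fintype.card V * (n ^ 2 + ρ * (n - W d))) :
    ∃ N K l m : ℕ, Γ.IsSRGWith N K l m ∧ N = Fintype.card V ∧
      0 < K ∧ (K : ℝ) = ((w₂ - n) * N - w₂) / (w₂ - w₁) ∧
      (l : ℝ) = (K * (w₁ ^ 2 / n - 2 * w₁) + w₂ * (K - 1)) / (w₂ - w₁) ∧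
      (m : ℝ) = (K * (w₁ * w₂ / n - w₁ - w₂) + w₂ * K) / (w₂ - w₁) := by
  classical
  obtain ⟨d₁, hd₁⟩ := hex₁
  obtain ⟨d₂, hd₂⟩ := hex₂
  have hδ : 0 < w₂ - w₁ := sub_pos.2 hw
  -- `P d` counts the common neighbours of two vertices with difference `d`
  let P (d : V) : ℕ := (Finset.univ.filter fun c => W c = w₁ ∧ W (d - c) = w₁).card
  set K : ℕ := (Finset.univ.filter fun v => W v = w₁).card with hK
  have e1 := sum_weight_eq h0 hW hw₁ hw
  have e2 := sum_weight_sq_eq h0 hW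
  -- at `d = 0` the convolution is the sum of squares, which expresses `ρ` by the other parameters
  have e3 := hconv 0
  simp only [zero_sub, hneg, ← sq, (h0 0).2 rfl, sub_zero] at e3
  rw [← hK] at e1
  rw [hsum] at e1 e2
  rw [e2] at e3
  have e4 {d : V} (hd : d ≠ 0) := sum_weight_mul_weight_eq h0 hW hw₁ hw hd
  simp only [hconv, hsum] at e4
  have hP₁ {d : V} (hd : W d = w₁) :
      (P d : ℝ) = (K * (w₁ ^ 2 / n - 2 * w₁) + w₂ * (K - 1)) / (w₂ - w₁) := by
    have e5 := e4 (d := d) (fun h => hw₁.ne' (hd ▸ (h0 d).2 h))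
    rw [if_pos hd, hd] at e5
    rw [eq_div_iff hδ.ne']
    field_simp
    apply mul_left_cancel₀ hδ.ne'
    simp only [P]
    linear_combination (-n) * e5 - (n - w₁) * e3 - (w₁ ^ 2 - 2 * w₁ * n + w₂ * n) * e1
  have hP₂ {d : V} (hd : W d = w₂) :
      (P d : ℝ) = (K * (w₁ * w₂ / n - w₁ - w₂) + w₂ * K) / (w₂ - w₁) := by
    have e5 := e4 (d := d) (fun h => (hw₁.trans hw).ne' (hd ▸ (h0 d).2 h))
    rw [if_neg (hd ▸ hw.ne'), hd] at e5
    rw [eq_div_iff hδ.ne']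
    field_simp
    apply mul_left_cancel₀ hδ.ne'
    simp only [P]
    linear_combination (-n) * e5 - (n - w₂) * e3 - (w₁ * w₂ - w₁ * n) * e1
  have hcommon (x y : V) : Fintype.card (Γ.commonNeighbors x y) = P (y - x) := by
    rw [← Set.toFinset_card]
    refine Finset.card_bij (fun z _ => z - x) ?_ (by simp) ?_
    · intro z hz
      simp only [Set.mem_toFinset, SimpleGraph.mem_commonNeighbors, hΓ] at hz
      simp only [Finset.mem_filter_univ]
      refine ⟨hz.1, ?_⟩
      rw [← hz.2, ← hneg]
      congr 1
      abel
    · intro c hc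
      simp only [Finset.mem_filter_univ] at hc
      refine ⟨c + x, ?_, by simp⟩
      simp only [Set.mem_toFinset, SimpleGraph.mem_commonNeighbors, hΓ]
      refine ⟨by simpa using hc.1, ?_⟩
      rw [← hc.2, ← hneg]
      congr 1
      abel
  refine ⟨Fintype.card V, K, P d₁, P d₂, ⟨rfl, ?_, ?_, ?_⟩, rfl, ?_, ?_, hP₁ hd₁, hP₂ hd₂⟩
  · intro x
    rw [← SimpleGraph.card_neighborFinset_eq_degree]
    refine Finset.card_bij (fun z _ => z - x) ?_ (by simp) ?_
    · intro z hz
      simpa [hΓ] using hz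
    · intro c hc
      exact ⟨c + x, by simpa [hΓ] using hc, by simp⟩
  · intro x y hxy
    rw [hcommon]
    have : (P (y - x) : ℝ) = P d₁ := by rw [hP₁ ((hΓ x y).1 hxy), hP₁ hd₁]
    exact_mod_cast this
  · intro x y hne hxy
    rw [hcommon]
    have h2 : W (y - x) = w₂ := by
      rcases hW (y - x) with h | h | h
      · exact absurd (sub_eq_zero.1 ((h0 _).1 h)).symm hne
      · exact absurd ((hΓ x y).2 h) hxy
      · exact h
    have : (P (y - x) : ℝ) = P d₂ := by rw [hP₂ h2, hP₂ hd₂]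
    exact_mod_cast this
  · exact Finset.card_pos.2 ⟨d₁, by simpa using hd₁⟩
  · rw [eq_div_iff hδ.ne']
    linear_combination e1

end Weight

/-! ### Trivial strongly regular graphs -/

/-- A strongly regular graph with two distinct nonadjacent vertices and `0 < m` is trivial if and
only if nonadjacent vertices have the same neighbours. -/
lemma isTrivialGraph_iff_of_isSRGWith {V : Type*} [Fintype V] [DecidableEq V]
    {Γ : SimpleGraph V} [DecidableRel Γ.Adj] {N K l m : ℕ} (h : Γ.IsSRGWith N K l m) (hm : 0 < m)
    (hna : ∃ x y, x ≠ y ∧ ¬Γ.Adj x y) : IsTrivialGraph Γ ↔ m = K := by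
  obtain ⟨a, b, hab, hnab⟩ := hna
  constructor
  · rintro (⟨s, -, hs, -⟩ | ⟨s, -, hs, -⟩)
    · -- a common neighbour of `a` and `b` would put them into the same clique
      have h1 := h.of_not_adj hab hnab
      obtain ⟨⟨z, hz⟩⟩ := Fintype.card_pos_iff.1 (h1 ▸ hm)
      rw [SimpleGraph.mem_commonNeighbors, hs, hs] at hz
      exact absurd ((hs a b).2 ⟨hab, s.trans hz.1.2 (s.symm hz.2.2)⟩) hnab
    · -- nonadjacency is transitive, so every neighbour of `a` is a neighbour of `b`
      have h1 := h.of_not_adj hab hnab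
      have hsab : s a b := ((hs a b).1 ((SimpleGraph.compl_adj _ _ _).2 ⟨hab, hnab⟩)).2
      have h2 : Γ.commonNeighbors a b = Γ.neighborSet a := by
        refine Set.inter_eq_left.2 fun z hz => ?_
        by_contra hbz
        rw [SimpleGraph.mem_neighborSet] at hz hbz
        have hsbz : s b z := by
          by_cases hb : b = z
          · exact hb ▸ s.refl _
          · exact ((hs b z).1 ((SimpleGraph.compl_adj _ _ _).2 ⟨hb, hbz⟩)).2
        exact ((SimpleGraph.compl_adj _ _ _).1
          ((hs a z).2 ⟨hz.ne, s.trans hsab hsbz⟩)).2 hz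
      rw [← h1, ← h.regular a, ← SimpleGraph.card_neighborSet_eq_degree]
      exact Fintype.card_congr (Equiv.setCongr h2)
  · rintro rfl
    right
    have hsub {x y z : V} (hxy : ¬Γ.Adj x y) (hxz : Γ.Adj x z) : Γ.Adj y z := by
      by_cases hne : x = y
      · exact hne ▸ hxz
      have h1 := h.of_not_adj hne hxy
      rw [← h.regular x, ← SimpleGraph.card_neighborSet_eq_degree, ← Set.toFinset_card,
        ← Set.toFinset_card] at h1
      have h2 : (Γ.commonNeighbors x y).toFinset = (Γ.neighborSet x).toFinset :=
        Finset.eq_of_subset_of_card_le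
          (Set.toFinset_subset_toFinset.2 Set.inter_subset_left) h1.ge
      have h3 : z ∈ (Γ.commonNeighbors x y).toFinset := by
        rw [h2]; simpa using hxz
      exact (Γ.mem_commonNeighbors.1 (Set.mem_toFinset.1 h3)).2
    refine ⟨⟨fun x y => ¬Γ.Adj x y, fun x => Γ.irrefl, fun h h' => h h'.symm,
      fun hxy hyz hxz => hyz (hsub hxy hxz)⟩, N - m, fun x y => by simp [SimpleGraph.compl_adj],
      fun x => ?_⟩
    have h1 : {y | ¬Γ.Adj x y} = (((Γ.neighborFinset x)ᶜ : Finset V) : Set V) := by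
      ext y; simp
    change {y | ¬Γ.Adj x y}.ncard = _
    rw [h1, Set.ncard_coe_finset, Finset.card_compl, SimpleGraph.card_neighborFinset_eq_degree,
      h.regular x, h.card]

/-! ### Weights modulo the words of weight zero -/

lemma card_mul_sum_comp_of_surjective {A B : Type*} [AddGroup A] [AddGroup B] [Fintype A]
    [Fintype B] (φ : A →+ B) (hφ : Function.Surjective φ) (F : B → ℂ) :
    (Fintype.card B : ℂ) * ∑ a, F (φ a) = Fintype.card A * ∑ b, F b := by
  classical
  have hfib (b : B) : (Finset.univ.filter fun a => φ a = b).card =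
      (Finset.univ.filter fun a => φ a = 0).card := by
    obtain ⟨a₀, rfl⟩ := hφ b
    refine Finset.card_bij (fun a _ => a - a₀) ?_ (by simp) ?_
    · intro a ha
      simp only [Finset.mem_filter_univ] at ha ⊢
      rw [map_sub, ha, sub_self]
    · intro a ha
      simp only [Finset.mem_filter_univ] at ha
      exact ⟨a + a₀, by simp [ha], by simp⟩
  have h1 (F : B → ℂ) : ∑ a, F (φ a) =
      (Finset.univ.filter fun a => φ a = 0).card * ∑ b, F b := by
    rw [← Finset.sum_fiberwise (s := Finset.univ) (g := φ), Finset.mul_sum]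
    refine Finset.sum_congr rfl fun b _ => ?_
    rw [Finset.sum_congr rfl fun a ha => by rw [(Finset.mem_filter.1 ha).2], Finset.sum_const, hfib,
      nsmul_eq_mul]
  have h2 := h1 fun _ => 1
  simp only [Finset.sum_const, Finset.card_univ, nsmul_eq_mul, mul_one] at h2
  rw [h1, h2]
  ring

section Quotient

variable {R : Type*} [Ring R] [Fintype R] [DecidableEq R] {χ : AddChar R ℂ} {n : ℕ}

lemma wordWeight_neg (c : Fin n → R) : wordWeight χ (-c) = wordWeight χ c := by
  refine Finset.sum_congr rfl fun j _ => ?_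
  unfold homWeight
  congr 2
  exact Fintype.sum_equiv (Equiv.neg Rˣ) _ _ fun u => by simp

lemma wordWeight_add_of_wordWeight_eq_zero (c : Fin n → R) {z : Fin n → R}
    (hz : wordWeight χ z = 0) : wordWeight χ (c + z) = wordWeight χ c := by
  rw [wordWeight_eq_zero_iff] at hz
  refine Finset.sum_congr rfl fun j _ => ?_
  simp [homWeight, mul_add, AddChar.map_add_eq_mul, hz j]

/-- The homogeneous weight, as a real-valued function on the quotient of a code by its words of
weight zero. -/
noncomputable def quotientWeight (χ : AddChar R ℂ) (C : Submodule R (Fin n → R))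
    (v : C ⧸ zeroWeight χ C) : ℝ :=
  (wordWeight χ (v.out : Fin n → R)).re

lemma quotientWeight_mk {C : Submodule R (Fin n → R)} (c : C) :
    quotientWeight χ C (QuotientAddGroup.mk c) = (wordWeight χ (c : Fin n → R)).re := by
  obtain ⟨z, hz⟩ := QuotientAddGroup.mk_out_eq_add (zeroWeight χ C) c
  rw [quotientWeight, hz, Submodule.coe_add]
  rw [wordWeight_add_of_wordWeight_eq_zero _ z.2]

end Quotient

end FrobeniusCode

open FrobeniusCode in
theorem mainTheorem1 {R : Type*} [Ring R] [Fintype R] [DecidableEq R]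
    (χ : AddChar R ℂ) (hχ : FrobeniusCode.IsGenerating χ)
    {n : ℕ} (C : Submodule R (Fin n → R)) (hmod : FrobeniusCode.IsModular C)
    (w₁ w₂ : ℝ) (hw : FrobeniusCode.IsTwoWeight χ C w₁ w₂)
    [Fintype (C ⧸ FrobeniusCode.zeroWeight χ C)]
    [DecidableEq (C ⧸ FrobeniusCode.zeroWeight χ C)]
    [DecidableRel (FrobeniusCode.codeGraph χ C w₁).Adj] :
    (∃ N K l m : ℕ,
      (FrobeniusCode.codeGraph χ C w₁).IsSRGWith N K l m ∧
      (N : ℝ) = (Nat.card C : ℝ) / (Nat.card (FrobeniusCode.zeroWeight χ C) : ℝ) ∧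
      (K : ℝ) = ((w₂ - n) * N - w₂) / (w₂ - w₁) ∧
      (l : ℝ) = (K * (w₁ ^ 2 / n - 2 * w₁) + w₂ * (K - 1)) / (w₂ - w₁) ∧
      (m : ℝ) = (K * (w₁ * w₂ / n - w₁ - w₂) + w₂ * K) / (w₂ - w₁)) ∧
    (FrobeniusCode.IsTrivialGraph (FrobeniusCode.codeGraph χ C w₁) ↔ w₁ = n) := by
  obtain ⟨hcol, k, G, r, hC, hr⟩ := hmod
  obtain ⟨hlt, hset⟩ := hw
  have hmem (x : Fin k → R) : Matrix.vecMul x G ∈ C := by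
    rw [← SetLike.mem_coe, hC]
    exact ⟨x, rfl⟩
  have hG (j : Fin n) : (fun i => G i j) ≠ 0 := by
    intro h
    obtain ⟨c, hc, hcj⟩ := hcol j
    rw [← SetLike.mem_coe, hC] at hc
    obtain ⟨x, rfl⟩ := hc
    apply hcj
    change x ⬝ᵥ (fun i => G i j) = 0
    rw [h, dotProduct_zero]
  have hval (c : C) : wordWeight χ (c : Fin n → R) = 0 ∨
      wordWeight χ (c : Fin n → R) = w₁ ∨ wordWeight χ (c : Fin n → R) = w₂ := by
    by_cases h : wordWeight χ (c : Fin n → R) = 0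
    · exact Or.inl h
    · have : wordWeight χ (c : Fin n → R) ∈ {z : ℂ | z ≠ 0 ∧ ∃ c ∈ C, wordWeight χ c = z} :=
        ⟨h, c, c.2, rfl⟩
      rw [hset] at this
      exact Or.inr this
  obtain ⟨hne₁, c₁, hc₁, hwc₁⟩ : (w₁ : ℂ) ∈ {z : ℂ | z ≠ 0 ∧ ∃ c ∈ C, wordWeight χ c = z} := by
    rw [hset]; exact Or.inl rfl
  obtain ⟨-, c₂, hc₂, hwc₂⟩ : (w₂ : ℂ) ∈ {z : ℂ | z ≠ 0 ∧ ∃ c ∈ C, wordWeight χ c = z} := by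
    rw [hset]; exact Or.inr rfl
  have hw₁ : 0 < w₁ := by
    refine lt_of_le_of_ne ?_ (fun h => hne₁ (by rw [← h, Complex.ofReal_zero]))
    have h1 : w₁ = (wordWeight χ c₁).re := by rw [hwc₁, Complex.ofReal_re]
    rw [h1, wordWeight, Complex.re_sum]
    exact Finset.sum_nonneg fun j _ => homWeight_re_nonneg χ _
  have hn : (0 : ℝ) < n := by
    rcases Nat.eq_zero_or_pos n with rfl | hn
    · exact absurd (by rw [← hwc₁]; simp [wordWeight]) hne₁
    · exact_mod_cast hn
  let W := quotientWeight χ C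
  have hWmk (c : C) : wordWeight χ (c : Fin n → R) = (W (QuotientAddGroup.mk c) : ℂ) := by
    rw [show W (QuotientAddGroup.mk c) = _ from quotientWeight_mk c]
    rcases hval c with h | h | h <;> rw [h] <;> simp
  have h0 (v) : W v = 0 ↔ v = 0 := by
    obtain ⟨c, rfl⟩ := QuotientAddGroup.mk_surjective v
    rw [QuotientAddGroup.eq_zero_iff, ← Complex.ofReal_eq_zero, ← hWmk]
    rfl
  have hW (v) : W v = 0 ∨ W v = w₁ ∨ W v = w₂ := by
    obtain ⟨c, rfl⟩ := QuotientAddGroup.mk_surjective v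
    have := hval c
    rw [hWmk] at this
    exact_mod_cast this
  have hneg (v) : W (-v) = W v := by
    obtain ⟨c, rfl⟩ := QuotientAddGroup.mk_surjective v
    rw [← QuotientAddGroup.mk_neg, ← Complex.ofReal_inj, ← hWmk, ← hWmk, Submodule.coe_neg,
      wordWeight_neg]
  have hΓ (x y) : (codeGraph χ C w₁).Adj x y ↔ W (y - x) = w₁ := by
    have hs (v) : (v ∈ (fun c : C => (QuotientAddGroup.mk c : C ⧸ zeroWeight χ C)) ''
        {c : C | wordWeight χ (c : Fin n → R) = (w₁ : ℂ)}) ↔ W v = w₁ := by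
      constructor
      · rintro ⟨c, hc, rfl⟩
        have hc' : wordWeight χ (c : Fin n → R) = (w₁ : ℂ) := hc
        rw [hWmk] at hc'
        exact_mod_cast hc'
      · intro hv
        obtain ⟨c, rfl⟩ := QuotientAddGroup.mk_surjective v
        exact ⟨c, (hWmk c).trans (by rw [hv]), rfl⟩
    rw [codeGraph, SimpleGraph.addCayley_adj']
    constructor
    · rintro ⟨-, g, hg, rfl | rfl⟩
      · rw [add_sub_cancel_left]; exact (hs g).1 hg
      · rw [sub_add_cancel_left, hneg]; exact (hs g).1 hg
    · intro h
      refine ⟨?_, y - x, (hs _).2 h, Or.inl (add_sub_cancel x y)⟩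
      rintro rfl
      rw [sub_self, (h0 0).2 rfl] at h
      exact hw₁.ne h
  -- averaging over the code is averaging over `R^k`
  let φ : (Fin k → R) →+ C ⧸ zeroWeight χ C :=
    (QuotientAddGroup.mk' (zeroWeight χ C)).comp
      { toFun := fun x => ⟨Matrix.vecMul x G, hmem x⟩
        map_zero' := Subtype.ext (Matrix.zero_vecMul G)
        map_add' := fun x y => Subtype.ext (Matrix.add_vecMul G x y) }
  have hφW (x : Fin k → R) : (W (φ x) : ℂ) = wordWeight χ (Matrix.vecMul x G) :=
    (hWmk ⟨Matrix.vecMul x G, hmem x⟩).symm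
  have hφ : Function.Surjective φ := by
    intro v
    obtain ⟨⟨c, hc⟩, rfl⟩ := QuotientAddGroup.mk_surjective v
    have hc' := hc
    rw [← SetLike.mem_coe, hC] at hc'
    obtain ⟨x, rfl⟩ := hc'
    exact ⟨x, rfl⟩
  have hcardR : (Fintype.card (Fin k → R) : ℂ) = (Fintype.card R : ℂ) ^ k := by simp
  have hR : (Fintype.card R : ℂ) ^ k ≠ 0 := pow_ne_zero _ (by exact_mod_cast Fintype.card_ne_zero)
  have hsum : ∑ v, W v = n * Fintype.card (C ⧸ zeroWeight χ C) := by
    have h1 := card_mul_sum_comp_of_surjective φ hφ fun v => (W v : ℂ)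
    simp only [hφW, sum_wordWeight_vecMul hχ hG, hcardR] at h1
    rw [← Complex.ofReal_inj]
    push_cast
    apply mul_left_cancel₀ hR
    rw [← h1]
    ring
  have hconv (d) : ∑ c, W c * W (d - c) =
      Fintype.card (C ⧸ zeroWeight χ C) * ((n : ℝ) ^ 2 + r * (n - W d)) := by
    obtain ⟨x, rfl⟩ := hφ d
    have h1 := card_mul_sum_comp_of_surjective φ hφ fun c => (W c * W (φ x - c) : ℂ)
    simp only [← map_sub, hφW, sum_wordWeight_mul_wordWeight hχ hG hr, hcardR] at h1
    rw [← Complex.ofReal_inj]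
    push_cast
    apply mul_left_cancel₀ hR
    rw [← h1, hφW]
    ring
  have hWc {w : ℝ} {c : Fin n → R} (hc : c ∈ C) (hwc : wordWeight χ c = w) :
      W (QuotientAddGroup.mk ⟨c, hc⟩) = w := by
    have := hWmk ⟨c, hc⟩
    rw [hwc] at this
    exact_mod_cast this.symm
  obtain ⟨N, K, l, m, hsrg, hN, hK0, hK, hl, hm⟩ := isSRGWith_of_weight hΓ h0 hW hneg hw₁ hlt
    ⟨_, hWc hc₁ hwc₁⟩ ⟨_, hWc hc₂ hwc₂⟩ hn hsum hconv
  refine ⟨⟨N, K, l, m, hsrg, ?_, hK, hl, hm⟩, ?_⟩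
  · rw [hN, eq_div_iff (by exact_mod_cast Nat.card_pos.ne'), ← Nat.card_eq_fintype_card]
    exact_mod_cast (AddSubgroup.card_eq_card_quotient_mul_card_addSubgroup _).symm
  · have hδ : 0 < w₂ - w₁ := sub_pos.2 hlt
    have hK0' : (0 : ℝ) < K := by exact_mod_cast hK0
    have hm' : (m : ℝ) * ((w₂ - w₁) * n) = K * (w₁ * (w₂ - n)) := by
      rw [hm]; field_simp; ring
    -- since `K > 0`, the formula for `K` gives `n < w₂`, so the formula for `m` gives `m > 0`
    have hw₂n : 0 < w₂ - n := by
      rw [eq_div_iff hδ.ne'] at hK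
      have h1 : 0 < (w₂ - n) * N := by nlinarith [mul_pos hK0' hδ]
      exact pos_of_mul_pos_left h1 (Nat.cast_nonneg N)
    have hm0 : 0 < m := by
      have h1 : 0 < (m : ℝ) * ((w₂ - w₁) * n) := by rw [hm']; positivity
      exact_mod_cast pos_of_mul_pos_left h1 (by positivity)
    rw [isTrivialGraph_iff_of_isSRGWith hsrg hm0
      ⟨0, QuotientAddGroup.mk ⟨c₂, hc₂⟩, ?_, ?_⟩]
    · constructor
      · rintro rfl
        have h1 : w₂ * (w₁ - n) = 0 := by
          linarith [mul_left_cancel₀ hK0'.ne' hm']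
        exact sub_eq_zero.1 ((mul_eq_zero.1 h1).resolve_left (hw₁.trans hlt).ne')
      · intro h
        rw [← h] at hm'
        have h1 : (m : ℝ) = K :=
          mul_right_cancel₀ (mul_pos hδ hw₁).ne' (hm'.trans (by ring))
        exact_mod_cast h1
    · intro h
      have h1 := hWc hc₂ hwc₂
      rw [← h, (h0 0).2 rfl] at h1
      exact (hw₁.trans hlt).ne h1
    · rw [hΓ, sub_zero, hWc hc₂ hwc₂]
      exact hlt.ne'
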